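/- Let $\mathbb N=\{0,1,2,\dots\}$ and let $S\subseteq\mathbb N^2$ be a (local) good semigroup, i.e. a submonoid of $(\mathbb N^2,+)$ such that (G1) $S$ is closed under componentwise minimum $\wedge$; (G2) if $\alpha,\beta\in S$ and $\alpha_i=\beta_i$ for some $i\in\{1,2\}$, then, with $j\ne i$, there is $\delta\in S$ with $\delta_i>\alpha_i=\beta_i$, $\delta_j\ge\min\{\alpha_j,\beta_j\}$, and $\delta_j=\min\{\alpha_j,\beta_j\}$ if $\alpha_j\neq\beta_j$; (G3) there is $c\in S$ with $c+\mathbb N^2\subseteq S$; and $(0,0)$ is the only element of $S$ with a zero component. Let $c$ be the conductor of $S$, i.e. the minimum of all $c$ with $c+\mathbb N^2\subseteq S$, and let $\gamma=c-(1,1)$. Let $\mathbf e=(e_1,e_2)$ be the minimum nonzero element of $S$, and let $e=e_1+e_2$. For $z\in\mathbb Z^2$ let $\Delta^S(z)$ be the set of $\beta\in S$ with $\beta_1=z_1,\ \beta_2>z_2$ or $\beta_2=z_2,\ \beta_1>z_1$. Assume that $S$ is symmetric: for all $\alpha\in\mathbb N^2$, $\alpha\in S$ if and only if $\Delta^S(\gamma-\alpha)=\emptyset$.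 Let $\mathrm{Ap}(S)=\{\alpha\in S:\alpha-\mathbf e\notin S\}$. Write $\alpha\le\le\beta$ if $\alpha=\beta$, or $\alpha_1<\beta_1$ and $\alpha_2<\beta_2$. For $i\ge1$ define recursively: $B^{(i)}$ is the set of $\le\le$-maximal elements of $\mathrm{Ap}(S)\setminus\bigcup_{j<i}D^{(j)}$; $C^{(i)}$ is the set of $\alpha\in B^{(i)}$ with $\alpha=\beta_1\wedge\beta_2$ for some $\beta_1,\beta_2\in B^{(i)}\setminus\{\alpha\}$; and $D^{(i)}=B^{(i)}\setminus C^{(i)}$. Let $N$ be the least integer with $\mathrm{Ap}(S)=\bigcup_{i=1}^{N}D^{(i)}$, and let $A_i=D^{(N+1-i)}$ for $1\le i\le N$ (the levels of $\mathrm{Ap}(S)$). Assume $e_1\ge e_2$. Then $N=e$, so $\mathrm{Ap}(S)=\bigcup_{i=1}^{e}A_i$, and: 1. If $e$ is even, there are elements $\alpha_1,\dots,\alpha_e$ with $\alpha_i\in A_i$ and $\alpha_i+\alpha_{e-i+1}=\alpha_e$ for all $1\le i\le e$. 2. If $e=2d-1$ is odd, there are elements $\alpha_1,\dots,\alpha_e,\beta$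 with $\alpha_i\in A_i$ for all $1\le i\le e$, $\beta\in A_d$, $\alpha_i+\alpha_{e-i+1}=\alpha_e$ for all $i\ne d$ with $1\le i\le e$, and $\alpha_d+\beta=\alpha_e$. -/

import Mathlib

namespace GoodSemi

/-- A (local) good subsemigroup of `ℕ²`: closed under componentwise infima, the exchange
property (for each of the two components), existence of a conductor, and locality
(`0` is the only element with a zero component). -/
structure IsGood (S : AddSubmonoid (ℕ × ℕ)) : Prop where
  inf_mem : ∀ α ∈ S, ∀ β ∈ S, α ⊓ β ∈ S
  exchange_fst : ∀ α ∈ S, ∀ β ∈ S, α.1 = β.1 →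
    ∃ δ ∈ S, α.1 < δ.1 ∧ min α.2 β.2 ≤ δ.2 ∧ (α.2 ≠ β.2 → δ.2 = min α.2 β.2)
  exchange_snd : ∀ α ∈ S, ∀ β ∈ S, α.2 = β.2 →
    ∃ δ ∈ S, α.2 < δ.2 ∧ min α.1 β.1 ≤ δ.1 ∧ (α.1 ≠ β.1 → δ.1 = min α.1 β.1)
  exists_conductor : ∃ c ∈ S, ∀ n : ℕ × ℕ, c + n ∈ S
  local_zero : ∀ α ∈ S, α.1 = 0 ∨ α.2 = 0 → α = 0

/-- The conductor `c`: the minimum of the elements `c` with `c + ℕ² ⊆ S`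
(the infimum in `ℕ × ℕ` is componentwise; see `isLeast_conductor`). -/
noncomputable def conductor (S : AddSubmonoid (ℕ × ℕ)) : ℕ × ℕ :=
  sInf {c : ℕ × ℕ | ∀ n : ℕ × ℕ, c + n ∈ S}

/-- The minimal nonzero element `𝐞 = (e₁, e₂)` of `S` (see `isLeast_minElt`). -/
noncomputable def minElt (S : AddSubmonoid (ℕ × ℕ)) : ℕ × ℕ :=
  sInf {α : ℕ × ℕ | α ∈ S ∧ α ≠ 0}

/-- `γ = c - (1, 1)`, an element of `ℤ²`. -/
noncomputable def gam (S : AddSubmonoid (ℕ × ℕ)) : ℤ × ℤ :=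
  (((conductor S).1 : ℤ) - 1, ((conductor S).2 : ℤ) - 1)

/-- `Δ^S(z)`, for `z ∈ ℤ²`: the elements of `S` sharing exactly one component with `z` and
having the other component strictly larger. -/
def DeltaS (S : AddSubmonoid (ℕ × ℕ)) (z : ℤ × ℤ) : Set (ℕ × ℕ) :=
  {β | β ∈ S ∧ (((β.1 : ℤ) = z.1 ∧ z.2 < (β.2 : ℤ)) ∨ ((β.2 : ℤ) = z.2 ∧ z.1 < (β.1 : ℤ)))}

/-- `S` is symmetric: `α ∈ S ↔ Δ^S(γ - α) = ∅` for all `α ∈ ℕ²`. -/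
def IsSymmetric (S : AddSubmonoid (ℕ × ℕ)) : Prop :=
  ∀ α : ℕ × ℕ, α ∈ S ↔ DeltaS S ((gam S).1 - (α.1 : ℤ), (gam S).2 - (α.2 : ℤ)) = ∅

/-- The Apéry set of `S` with respect to its minimal nonzero element `𝐞`:
the `α ∈ S` with `α - 𝐞 ∉ S`. -/
def apery (S : AddSubmonoid (ℕ × ℕ)) : Set (ℕ × ℕ) :=
  {α | α ∈ S ∧ ¬ ∃ s ∈ S, s + minElt S = α}

/-- `α ≪ β`: strict inequality in both components. -/
def LtLt (α β : ℕ × ℕ) : Prop := α.1 < β.1 ∧ α.2 < β.2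

/-- `α ≤≤ β`: `α = β` or `α ≪ β`. -/
def LeLe (α β : ℕ × ℕ) : Prop := α = β ∨ LtLt α β

/-- The elements of `X` that are maximal in `X` with respect to `≤≤`. -/
def maxSet (X : Set (ℕ × ℕ)) : Set (ℕ × ℕ) :=
  {α | α ∈ X ∧ ∀ β ∈ X, LeLe α β → β = α}

/-- The elements of `B` that are infima of two elements of `B \ {α}`. -/
def infSet (B : Set (ℕ × ℕ)) : Set (ℕ × ℕ) :=
  {α | α ∈ B ∧ ∃ β₁ ∈ B \ {α}, ∃ β₂ ∈ B \ {α}, α = β₁ ⊓ β₂}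

/-- `remaining S k` is the Apéry set with `D⁽¹⁾, …, D⁽ᵏ⁾` removed, where
`D⁽ᵏ⁺¹⁾ = B⁽ᵏ⁺¹⁾ \ C⁽ᵏ⁺¹⁾` is formed from `remaining S k`. -/
def remaining (S : AddSubmonoid (ℕ × ℕ)) : ℕ → Set (ℕ × ℕ)
  | 0 => apery S
  | k + 1 => remaining S k \ (maxSet (remaining S k) \ infSet (maxSet (remaining S k)))

/-- `layer S k` is `D⁽ᵏ⁺¹⁾`. -/
def layer (S : AddSubmonoid (ℕ × ℕ)) (k : ℕ) : Set (ℕ × ℕ) :=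
  maxSet (remaining S k) \ infSet (maxSet (remaining S k))

/-- The number `N` of levels: the least `N` such that the Apéry set is the union of
`D⁽¹⁾, …, D⁽ᴺ⁾`. -/
noncomputable def numLevels (S : AddSubmonoid (ℕ × ℕ)) : ℕ :=
  sInf {N : ℕ | apery S = ⋃ k ∈ Finset.range N, layer S k}

/-- The level `A_i = D⁽ᴺ⁺¹⁻ⁱ⁾`, for `1 ≤ i ≤ N` (and empty for other `i`). -/
def level (S : AddSubmonoid (ℕ × ℕ)) (i : ℕ) : Set (ℕ × ℕ) :=
  {α | 1 ≤ i ∧ ∃ k : ℕ, k + i = numLevels S ∧ α ∈ layer S k}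

/-- A nonempty subset of `ℕ²` closed under infima contains its (componentwise) infimum. -/
theorem isLeast_sInf {X : Set (ℕ × ℕ)} (hne : X.Nonempty)
    (hX : ∀ α ∈ X, ∀ β ∈ X, α ⊓ β ∈ X) : IsLeast X (sInf X) := by
  have h1 : sInf (Prod.fst '' X) ∈ Prod.fst '' X := Nat.sInf_mem (hne.image _)
  have h2 : sInf (Prod.snd '' X) ∈ Prod.snd '' X := Nat.sInf_mem (hne.image _)
  have lb : ∀ β ∈ X, sInf X ≤ β := fun β hβ =>
    ⟨Nat.sInf_le (Set.mem_image_of_mem _ hβ), Nat.sInf_le (Set.mem_image_of_mem _ hβ)⟩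
  obtain ⟨a, ha, ha'⟩ := h1
  obtain ⟨b, hb, hb'⟩ := h2
  refine ⟨?_, lb⟩
  have hab : sInf X = a ⊓ b := by
    apply le_antisymm (le_inf (lb a ha) (lb b hb))
    exact ⟨le_trans inf_le_left ha'.le, le_trans inf_le_right hb'.le⟩
  rw [hab]
  exact hX a ha b hb

theorem IsGood.isLeast_conductor {S : AddSubmonoid (ℕ × ℕ)} (hS : IsGood S) :
    IsLeast {c : ℕ × ℕ | ∀ n : ℕ × ℕ, c + n ∈ S} (conductor S) := by
  obtain ⟨c, -, hc⟩ := hS.exists_conductor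
  refine isLeast_sInf ⟨c, hc⟩ ?_
  intro α hα β hβ n
  have key : ∀ x y : ℕ × ℕ, x ≤ y → (∀ n, x + n ∈ S) → y ∈ S := fun x y hxy hx => by
    have := hx (y - x)
    rwa [add_tsub_cancel_of_le hxy] at this
  set m : ℕ × ℕ := α ⊓ β + n with hm
  have e : m = (m ⊔ α) ⊓ (m ⊔ β) := by
    rw [← sup_inf_left]
    exact (sup_eq_left.2 (hm ▸ le_self_add)).symm
  rw [e]
  exact hS.inf_mem _ (key α _ le_sup_right hα) _ (key β _ le_sup_right hβ)

theorem IsGood.isLeast_minElt {S : AddSubmonoid (ℕ × ℕ)} (hS : IsGood S) :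
    IsLeast {α : ℕ × ℕ | α ∈ S ∧ α ≠ 0} (minElt S) := by
  refine isLeast_sInf ?_ ?_
  · obtain ⟨c, -, hc⟩ := hS.exists_conductor
    refine ⟨c + (1, 1), hc _, fun h => ?_⟩
    have := congrArg Prod.fst h
    simp at this
  · rintro α ⟨hα, hα0⟩ β ⟨hβ, hβ0⟩
    refine ⟨hS.inf_mem _ hα _ hβ, fun h => ?_⟩
    have h1 : min α.1 β.1 = 0 := congrArg Prod.fst h
    rcases min_choice α.1 β.1 with h' | h'
    · exact hα0 (hS.local_zero α hα (Or.inl (h' ▸ h1)))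
    · exact hβ0 (hS.local_zero β hβ (Or.inl (h' ▸ h1)))

end GoodSemi

/-! Put `E = 𝐞 + S`, so that the Apéry set is `S \ E`. Walk from the origin to `(x, y)` by unit
steps, counting a step right when `S` meets the part of the column being left at or above the
current height and `E` does not, and symmetrically for steps up. Goodness makes the count
independent of the path (`gap_square`). The resulting `rank` is monotone, has maximum `e` and
increases strictly along `≪` on the Apéry set. Peeling off a layer removes exactly the elements of
top rank (`maxSet_diff_infSet`), so `A_i` consists of the Apéry elements of rank `i - 1`, and `N =
e`.

Symmetry enters through the columns far up: there, column `x` is a gap iff `c₁ + e₁ - 1 - x` is an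
Apéry element `u` of the first projection (`colGap_iff_of_symm`), and ranks are complementary
(`rank_reflect`). For `i ≤ e₁` the `i`-th such `u` carries an element of `A_i`, while every high
point of the reflected column lies in `A_{e+1-i}`. The abscissas have constant sum and the height is
free, so all these pairs can be given the same sum `ω`. As `e₁ ≥ e₂`, the indices `i ≤ e₁` cover the
lower half of the levels. -/

namespace GoodSemi

attribute [local instance] Classical.propDecidable

/-! ### Gaps, rank and path independence -/

/-- `T` has a point in the column `x` at height at least `y`. -/
def ColHit (T : Set (ℕ × ℕ)) (x y : ℕ) : Prop := ∃ b, y ≤ b ∧ (x, b) ∈ T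

/-- `T` has a point in the row `y` with abscissa at least `x`. -/
def RowHit (T : Set (ℕ × ℕ)) (x y : ℕ) : Prop := ∃ a, x ≤ a ∧ (a, y) ∈ T

/-- A column gap is a jump of the rank between `(x, y)` and `(x + 1, y)`; a row gap is one between
`(x, y)` and `(x, y + 1)`. -/
def ColGap (A E : Set (ℕ × ℕ)) (x y : ℕ) : Prop := ColHit A x y ∧ ¬ ColHit E x y

def RowGap (A E : Set (ℕ × ℕ)) (x y : ℕ) : Prop := RowHit A x y ∧ ¬ RowHit E x y

open Classical in
/-- The number of gaps on a lattice path from the origin to `(x, y)`; for `E ⊆ A` good it plays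
the role of the length of `A / (E + A(x, y))`. -/
noncomputable def rank (A E : Set (ℕ × ℕ)) (x y : ℕ) : ℕ :=
  Nat.count (fun i => ColGap A E i 0) x + Nat.count (fun j => RowGap A E x j) y

/-- Closure under infima together with the exchange property in the form in which it is used. -/
structure IsGoodSet (T : Set (ℕ × ℕ)) : Prop where
  inf_mem : ∀ α ∈ T, ∀ β ∈ T, α ⊓ β ∈ T
  row_iff_col : ∀ x y, (x, y) ∈ T → (RowHit T (x + 1) y ↔ ColHit T x (y + 1))

theorem IsGoodSet.mem_of_hits {T : Set (ℕ × ℕ)} (hT : IsGoodSet T) {x y : ℕ}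
    (hc : ColHit T x y) (hr : RowHit T x y) : (x, y) ∈ T := by
  obtain ⟨b, hb, hb'⟩ := hc
  obtain ⟨a, ha, ha'⟩ := hr
  have h := hT.inf_mem _ hb' _ ha'
  have h2 : (x, b) ⊓ (a, y) = (x, y) := Prod.ext (min_eq_left ha) (min_eq_right hb)
  rwa [h2] at h

theorem colHit_iff (T : Set (ℕ × ℕ)) (x y : ℕ) :
    ColHit T x y ↔ (x, y) ∈ T ∨ ColHit T x (y + 1) := by
  constructor
  · rintro ⟨b, hb, h⟩
    rcases hb.eq_or_lt with rfl | hb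
    · exact Or.inl h
    · exact Or.inr ⟨b, hb, h⟩
  · rintro (h | ⟨b, hb, h⟩)
    · exact ⟨y, le_rfl, h⟩
    · exact ⟨b, by omega, h⟩

theorem rowHit_iff (T : Set (ℕ × ℕ)) (x y : ℕ) :
    RowHit T x y ↔ (x, y) ∈ T ∨ RowHit T (x + 1) y := by
  constructor
  · rintro ⟨b, hb, h⟩
    rcases hb.eq_or_lt with rfl | hb
    · exact Or.inl h
    · exact Or.inr ⟨b, hb, h⟩
  · rintro (h | ⟨b, hb, h⟩)
    · exact ⟨x, le_rfl, h⟩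
    · exact ⟨b, by omega, h⟩

theorem ColHit.mono {T U : Set (ℕ × ℕ)} (h : T ⊆ U) {x y : ℕ} : ColHit T x y → ColHit U x y :=
  fun ⟨b, hb, hT⟩ => ⟨b, hb, h hT⟩

theorem RowHit.mono {T U : Set (ℕ × ℕ)} (h : T ⊆ U) {x y : ℕ} : RowHit T x y → RowHit U x y :=
  fun ⟨b, hb, hT⟩ => ⟨b, hb, h hT⟩

/-- `E ⊆ A` are good, `E` meets every column and row from `M` on in points arbitrarily far out,
and `n` is the rank of the points beyond `(M, M)`. -/
structure GoodPair (A E : Set (ℕ × ℕ)) (M n : ℕ) : Prop where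
  sub : E ⊆ A
  good : IsGoodSet A
  good' : IsGoodSet E
  col : ∀ x y, M ≤ x → ColHit E x y
  row : ∀ x y, M ≤ y → RowHit E x y
  rank_eq : ∀ x y, M ≤ x → M ≤ y → rank A E x y = n

theorem rank_succ_snd (A E : Set (ℕ × ℕ)) (x y : ℕ) :
    rank A E x (y + 1) = rank A E x y + if RowGap A E x y then 1 else 0 := by
  simp only [rank, Nat.count_succ]
  ring

/-- The two paths around a unit square meet equally many gaps. Only the corner `(x, y)` matters:
beyond it, row and column hits are equivalent at a point of a good set, and if the corner is not in
`E`, closure under infima forbids `E` to hit both its column and its row. -/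
theorem gap_square {A E : Set (ℕ × ℕ)} (hE : E ⊆ A) (hA : IsGoodSet A) (hE' : IsGoodSet E)
    (x y : ℕ) :
    (if ColGap A E x y then 1 else 0) + (if RowGap A E (x + 1) y then 1 else 0)
      = (if RowGap A E x y then 1 else 0) + (if ColGap A E x (y + 1) then 1 else 0 : ℕ) := by
  have h1 := colHit_iff A x y
  have h2 := colHit_iff E x y
  have h3 := rowHit_iff A x y
  have h4 := rowHit_iff E x y
  have h5 := hA.row_iff_col x y
  have h6 := hE'.row_iff_col x y
  have h7 : (x, y) ∈ E → (x, y) ∈ A := fun h => hE h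
  have h8 : ColHit E x (y + 1) → ColHit A x (y + 1) := ColHit.mono hE
  have h9 : RowHit E (x + 1) y → RowHit A (x + 1) y := RowHit.mono hE
  have h10 : ColHit E x y → RowHit E x y → (x, y) ∈ E := hE'.mem_of_hits
  unfold ColGap RowGap
  rw [h1, h2, h3, h4] at *
  by_cases a1 : (x, y) ∈ A <;> by_cases a2 : (x, y) ∈ E <;>
  by_cases a3 : ColHit A x (y + 1) <;> by_cases a4 : ColHit E x (y + 1) <;>
  by_cases a5 : RowHit A (x + 1) y <;> by_cases a6 : RowHit E (x + 1) y <;>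
  simp_all

theorem rank_succ_fst {A E : Set (ℕ × ℕ)} (hE : E ⊆ A) (hA : IsGoodSet A) (hE' : IsGoodSet E)
    (x y : ℕ) : rank A E (x + 1) y = rank A E x y + if ColGap A E x y then 1 else 0 := by
  induction y with
  | zero =>
    simp only [rank, Nat.count_succ, Nat.count_zero]
    ring
  | succ y ih =>
    have := gap_square hE hA hE' x y
    rw [rank_succ_snd, rank_succ_snd, ih]
    omega

theorem rank_eq_add_count {A E : Set (ℕ × ℕ)} (hE : E ⊆ A) (hA : IsGoodSet A)
    (hE' : IsGoodSet E) (x y : ℕ) :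
    rank A E x y = rank A E 0 y + Nat.count (fun i => ColGap A E i y) x := by
  induction x with
  | zero => simp
  | succ x ih =>
    rw [rank_succ_fst hE hA hE', ih, Nat.count_succ]
    ring

/-! ### Layers as level sets of the rank -/

namespace GoodPair

variable {A E : Set (ℕ × ℕ)} {M n : ℕ}

theorem rank_succ_fst (h : GoodPair A E M n) (x y : ℕ) :
    rank A E (x + 1) y = rank A E x y + if ColGap A E x y then 1 else 0 :=
  GoodSemi.rank_succ_fst h.sub h.good h.good' x y

theorem rank_mono (h : GoodPair A E M n) {x y x' y' : ℕ} (hx : x ≤ x') (hy : y ≤ y') :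
    rank A E x y ≤ rank A E x' y' := by
  refine le_trans (b := rank A E x' y) ?_ ?_
  · exact monotone_nat_of_le_succ (f := fun i => rank A E i y)
      (fun i => by simp only [h.rank_succ_fst i y]; omega) hx
  · exact monotone_nat_of_le_succ (f := fun i => rank A E x' i)
      (fun i => by simp only [rank_succ_snd]; omega) hy

theorem rank_le (h : GoodPair A E M n) (x y : ℕ) : rank A E x y ≤ n := by
  rw [← h.rank_eq (max x M) (max y M) (le_max_right _ _) (le_max_right _ _)]
  exact h.rank_mono (le_max_left _ _) (le_max_left _ _)

theorem rank_fst_eq (h : GoodPair A E M n) {x x' : ℕ} (y : ℕ) (hx : M ≤ x) (hx' : x ≤ x') :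
    rank A E x' y = rank A E x y := by
  induction x', hx' using Nat.le_induction with
  | base => rfl
  | succ k hk ih =>
    rw [h.rank_succ_fst, ih, if_neg, add_zero]
    exact fun hg => hg.2 (h.col k y (hx.trans hk))

theorem rank_snd_eq (h : GoodPair A E M n) {y y' : ℕ} (x : ℕ) (hy : M ≤ y) (hy' : y ≤ y') :
    rank A E x y' = rank A E x y := by
  induction y', hy' using Nat.le_induction with
  | base => rfl
  | succ k hk ih =>
    rw [rank_succ_snd, ih, if_neg, add_zero]
    exact fun hg => hg.2 (h.row x k (hy.trans hk))

/-- Every rank below the maximal one is attained on `A \ E`, above any point of that rank. -/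
theorem exists_mem_diff (h : GoodPair A E M n) {x y : ℕ} (hp : rank A E x y < n) :
    ∃ β ∈ A \ E, x ≤ β.1 ∧ y ≤ β.2 ∧ rank A E β.1 β.2 = rank A E x y := by
  set K := max M (max x y) with hK
  let F : Finset (ℕ × ℕ) :=
    (Finset.Icc x K ×ˢ Finset.Icc y K).filter fun q => rank A E q.1 q.2 = rank A E x y
  have hF : ∀ q, q ∈ F ↔ ((x ≤ q.1 ∧ q.1 ≤ K) ∧ y ≤ q.2 ∧ q.2 ≤ K) ∧
      rank A E q.1 q.2 = rank A E x y := fun q => by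
    simp only [F, Finset.mem_filter, Finset.mem_product, Finset.mem_Icc]
  -- At a point of the given rank that is farthest out in the box, each step staying in the box
  -- meets a gap. Two gaps put the point itself in `A \ E`; on the edge of the box the witness of
  -- the single gap serves, since the rank is constant beyond `M`.
  obtain ⟨⟨a, b⟩, hq, hmax⟩ := F.exists_max_image (fun q => q.1 + q.2)
    ⟨(x, y), (hF _).2 ⟨by simp only [hK]; omega, rfl⟩⟩
  obtain ⟨⟨⟨hxa, haK⟩, hyb, hbK⟩, hr⟩ := (hF _).1 hq
  simp only at hxa haK hyb hbK hr hmax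
  have hne : a < K ∨ b < K := by
    by_contra! hcon
    have := h.rank_eq a b (by omega) (by omega)
    omega
  have hcol : a < K → ColGap A E a b := fun ha => by
    by_contra hg
    have h1 := h.rank_succ_fst a b
    rw [if_neg hg, add_zero] at h1
    have := hmax (a + 1, b) ((hF _).2 ⟨by simp only; omega, by simp only; omega⟩)
    simp only at this
    omega
  have hrow : b < K → RowGap A E a b := fun hb => by
    by_contra hg
    have h1 := rank_succ_snd A E a b
    rw [if_neg hg, add_zero] at h1
    have := hmax (a, b + 1) ((hF _).2 ⟨by simp only; omega, by simp only; omega⟩)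
    simp only at this
    omega
  by_cases ha : a < K
  · by_cases hb : b < K
    · refine ⟨(a, b), ⟨h.good.mem_of_hits (hcol ha).1 (hrow hb).1, fun hE => ?_⟩, hxa, hyb, hr⟩
      exact (hcol ha).2 ⟨b, le_rfl, hE⟩
    · obtain ⟨⟨d, hd, hdA⟩, hg⟩ := hcol ha
      refine ⟨(a, d), ⟨hdA, fun hE => hg ⟨d, hd, hE⟩⟩, hxa, hyb.trans hd, ?_⟩
      simp only
      rw [← hr]
      exact h.rank_snd_eq a (by omega) hd
  · obtain ⟨⟨d, hd, hdA⟩, hg⟩ := hrow (hne.resolve_left ha)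
    refine ⟨(d, b), ⟨hdA, fun hE => hg ⟨d, hd, hE⟩⟩, hxa.trans hd, hyb, ?_⟩
    simp only
    rw [← hr]
    exact h.rank_fst_eq b (by omega) hd

/-- One of the two unit steps out of `α` meets a gap: otherwise `E` would hit both the column and
the row of `α`, hence contain `α`. -/
theorem rank_lt_of_lt (h : GoodPair A E M n) {α : ℕ × ℕ} (hα : α ∈ A \ E) :
    rank A E α.1 α.2 < rank A E (α.1 + 1) (α.2 + 1) := by
  have h1 : ColHit A α.1 α.2 := ⟨α.2, le_rfl, hα.1⟩
  have h2 : RowHit A α.1 α.2 := ⟨α.1, le_rfl, hα.1⟩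
  by_cases hc : ColHit E α.1 α.2
  · have hg : RowGap A E α.1 α.2 := ⟨h2, fun hr => hα.2 (h.good'.mem_of_hits hc hr)⟩
    have := rank_succ_snd A E α.1 α.2
    rw [if_pos hg] at this
    have := h.rank_mono (x := α.1) (x' := α.1 + 1) (y := α.2 + 1) (y' := α.2 + 1)
      (by omega) le_rfl
    omega
  · have := h.rank_succ_fst α.1 α.2
    rw [if_pos ⟨h1, hc⟩] at this
    have := h.rank_mono (x := α.1 + 1) (x' := α.1 + 1) (y := α.2) (y' := α.2 + 1)
      le_rfl (by omega)
    omega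

theorem rank_lt (h : GoodPair A E M n) {α : ℕ × ℕ} (hα : α ∈ A \ E) : rank A E α.1 α.2 < n :=
  (h.rank_lt_of_lt hα).trans_le (h.rank_le _ _)

theorem exists_rank_eq (h : GoodPair A E M n) {m : ℕ} (hm : m < n) :
    ∃ β ∈ A \ E, rank A E β.1 β.2 = m := by
  have h0 : rank A E 0 0 = 0 := by simp [rank]
  have key : ∀ k : ℕ, ∃ p : ℕ × ℕ, rank A E p.1 p.2 = min k n := by
    intro k
    induction k with
    | zero => exact ⟨(0, 0), by simpa using h0⟩
    | succ k ih =>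
      obtain ⟨p, hp⟩ := ih
      rcases le_or_gt n k with hk | hk
      · exact ⟨p, by omega⟩
      · obtain ⟨β, hβ, -, -, hr⟩ := h.exists_mem_diff (x := p.1) (y := p.2) (by omega)
        have hc := h.rank_succ_fst β.1 β.2
        have hd := rank_succ_snd A E β.1 β.2
        by_cases hg : ColGap A E β.1 β.2
        · exact ⟨(β.1 + 1, β.2), by rw [if_pos hg] at hc; simp only; omega⟩
        · have hcE : ColHit E β.1 β.2 := by
            by_contra hcE
            exact hg ⟨⟨β.2, le_rfl, hβ.1⟩, hcE⟩
          have hg' : RowGap A E β.1 β.2 :=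
            ⟨⟨β.1, le_rfl, hβ.1⟩, fun hr => hβ.2 (h.good'.mem_of_hits hcE hr)⟩
          exact ⟨(β.1, β.2 + 1), by rw [if_pos hg'] at hd; simp only; omega⟩
  obtain ⟨p, hp⟩ := key m
  obtain ⟨β, hβ, -, -, hr⟩ := h.exists_mem_diff (x := p.1) (y := p.2) (by omega)
  exact ⟨β, hβ, by omega⟩

theorem mem_maxSet (h : GoodPair A E M n) {m : ℕ} {α : ℕ × ℕ} (hα : α ∈ A \ E)
    (hr : rank A E α.1 α.2 = m) : α ∈ maxSet {α ∈ A \ E | rank A E α.1 α.2 ≤ m} := by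
  refine ⟨⟨hα, hr.le⟩, fun β hβ hle => ?_⟩
  rcases hle with rfl | ⟨h1, h2⟩
  · rfl
  · have := h.rank_lt_of_lt hα
    have h3 := h.rank_mono (x := α.1 + 1) (x' := β.1) (y := α.2 + 1) (y' := β.2) h1 h2
    have h4 := hβ.2
    omega

/-- Peeling off the top layer removes exactly the elements of the largest rank. -/
theorem maxSet_diff_infSet (h : GoodPair A E M n) {m : ℕ} (hm : m < n) :
    maxSet {α ∈ A \ E | rank A E α.1 α.2 ≤ m} \
      infSet (maxSet {α ∈ A \ E | rank A E α.1 α.2 ≤ m}) =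
    {α ∈ A \ E | rank A E α.1 α.2 = m} := by
  ext α
  constructor
  · rintro ⟨⟨⟨hα, hr⟩, hmax⟩, hinf⟩
    refine ⟨hα, hr.antisymm ?_⟩
    by_contra! hlt
    have hup : ∀ β ∈ A \ E, α.1 < β.1 → α.2 < β.2 → m < rank A E β.1 β.2 := by
      intro β hβ h1 h2
      by_contra! h3
      rw [hmax β ⟨hβ, h3⟩ (Or.inr ⟨h1, h2⟩)] at h1
      exact lt_irrefl _ h1
    -- Maximality of `α` excludes Apéry elements of rank at most `m` strictly beyond it, while every
    -- rank below `n` is attained above any point having it.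
    have hdiag : m < rank A E (α.1 + 1) (α.2 + 1) := by
      by_contra! hle
      obtain ⟨β, hβ, h1, h2, h3⟩ := h.exists_mem_diff (hle.trans_lt hm)
      have := hup β hβ h1 h2
      omega
    have s1 := h.rank_succ_fst α.1 α.2
    have s2 := rank_succ_snd A E α.1 α.2
    have s3 := h.rank_succ_fst α.1 (α.2 + 1)
    have s4 := rank_succ_snd A E (α.1 + 1) α.2
    -- The diagonal step raises the rank by at most two, from below `m` to above `m`, so each unit
    -- step raises it by exactly one.
    have e1 : rank A E α.1 (α.2 + 1) = m := by split_ifs at * <;> omega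
    have e2 : rank A E (α.1 + 1) α.2 = m := by split_ifs at * <;> omega
    obtain ⟨β, hβ, b1, b2, hβr⟩ := h.exists_mem_diff (e1.trans_lt hm)
    obtain ⟨δ, hδ, d1, d2, hδr⟩ := h.exists_mem_diff (e2.trans_lt hm)
    have b1' : β.1 = α.1 := by
      by_contra hne
      have := hup β hβ (by omega) (by omega)
      omega
    have d2' : δ.2 = α.2 := by
      by_contra hne
      have := hup δ hδ (by omega) (by omega)
      omega
    refine hinf ⟨⟨⟨hα, hr⟩, hmax⟩, β, ⟨h.mem_maxSet hβ (hβr.trans e1), ?_⟩, δ,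
      ⟨h.mem_maxSet hδ (hδr.trans e2), ?_⟩, ?_⟩
    · rintro rfl
      omega
    · rintro rfl
      omega
    · refine Prod.ext ?_ ?_
      · change α.1 = min β.1 δ.1
        omega
      · change α.2 = min β.2 δ.2
        omega
  · rintro ⟨hα, hr⟩
    refine ⟨h.mem_maxSet hα hr, ?_⟩
    rintro ⟨-, β, ⟨⟨⟨hβ, hβr⟩, -⟩, hβα⟩, δ, ⟨⟨⟨hδ, hδr⟩, -⟩, hδα⟩, heq⟩
    have i1 : α.1 = min β.1 δ.1 := congrArg Prod.fst heq
    have i2 : α.2 = min β.2 δ.2 := congrArg Prod.snd heq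
    have hne : ¬ (β.1 = α.1 ∧ β.2 = α.2) := fun hh => hβα (Prod.ext hh.1 hh.2)
    have hne' : ¬ (δ.1 = α.1 ∧ δ.2 = α.2) := fun hh => hδα (Prod.ext hh.1 hh.2)
    -- If `α` of rank `m` were such an infimum, both unit steps out of it would stay at rank `m`, so
    -- neither is a gap and `α` lies in `E`.
    have main : ∀ β δ : ℕ × ℕ, rank A E β.1 β.2 ≤ m → rank A E δ.1 δ.2 ≤ m →
        α.1 ≤ β.1 → α.2 + 1 ≤ β.2 → α.1 + 1 ≤ δ.1 → α.2 ≤ δ.2 → False := by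
      intro β δ hβr hδr c1 c2 c3 c4
      have r1 := h.rank_mono c1 c2
      have r2 := h.rank_mono c3 c4
      have s1 := h.rank_succ_fst α.1 α.2
      have s2 := rank_succ_snd A E α.1 α.2
      have g1 : ¬ ColGap A E α.1 α.2 := fun hg => by rw [if_pos hg] at s1; omega
      have g2 : ¬ RowGap A E α.1 α.2 := fun hg => by rw [if_pos hg] at s2; omega
      have k1 : ColHit E α.1 α.2 := by
        by_contra hn
        exact g1 ⟨⟨α.2, le_rfl, hα.1⟩, hn⟩
      have k2 : RowHit E α.1 α.2 := by
        by_contra hn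
        exact g2 ⟨⟨α.1, le_rfl, hα.1⟩, hn⟩
      exact hα.2 (h.good'.mem_of_hits k1 k2)
    by_cases hc : β.1 = α.1
    · exact main β δ hβr hδr (by omega) (by omega) (by omega) (by omega)
    · exact main δ β hδr hβr (by omega) (by omega) (by omega) (by omega)

end GoodPair

/-! ### The translate of `S` and Apéry counts in one variable -/

/-- The translate `𝐞 + S`. -/
def shiftSet (S : AddSubmonoid (ℕ × ℕ)) : Set (ℕ × ℕ) := {α | ∃ s ∈ S, s + minElt S = α}

theorem apery_eq (S : AddSubmonoid (ℕ × ℕ)) : apery S = (S : Set (ℕ × ℕ)) \ shiftSet S := rfl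

/-- The elements `t` of a set of naturals with `t - a` not in the set. -/
def AperyNat (T : ℕ → Prop) (a i : ℕ) : Prop := T i ∧ ¬ ∃ t, T t ∧ t + a = i

/-- The elements of `T` below `m + a` are the Apéry ones together with the translates of those below
`m`. -/
theorem count_aperyNat_add {T : ℕ → Prop} {a : ℕ} (hT : ∀ t, T t → T (t + a)) (m : ℕ) :
    Nat.count (AperyNat T a) (m + a) + Nat.count T m = Nat.count T (m + a) := by
  have aux : ∀ k, Nat.count (AperyNat T a) k + Nat.count (fun i => ∃ t, T t ∧ t + a = i) k
      = Nat.count T k := by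
    intro k
    induction k with
    | zero => simp
    | succ k ih =>
      have h1 : (∃ t, T t ∧ t + a = k) → T k := by
        rintro ⟨t, ht, rfl⟩
        exact hT t ht
      simp only [Nat.count_succ, AperyNat] at ih ⊢
      by_cases h2 : T k <;> by_cases h3 : ∃ t, T t ∧ t + a = k
      · simp only [h2, h3, not_true_eq_false, and_false, if_true, if_false]; omega
      · simp only [h2, h3, not_false_eq_true, and_true, if_true, if_false]; omega
      · exact absurd (h1 h3) h2
      · simp only [h2, h3, false_and, if_false]; omega
  rw [← aux (m + a)]
  congr 1
  rw [add_comm m a, Nat.count_add]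
  have h0 : Nat.count (fun i => ∃ t, T t ∧ t + a = i) a = 0 := by
    rw [← Nat.count_false a]
    apply le_antisymm
    · rw [Nat.count_eq_card_filter_range, Nat.count_eq_card_filter_range]
      refine Finset.card_le_card fun i hi => ?_
      obtain ⟨hi, t, -, ht⟩ := Finset.mem_filter.1 hi
      have := Finset.mem_range.1 hi
      omega
    · simp
  rw [h0, zero_add]
  congr 1
  funext i
  refine propext ⟨fun h => ⟨i, h, add_comm _ _⟩, ?_⟩
  rintro ⟨t, ht, h⟩
  rwa [show i = t by omega]

/-- A cofinite set of naturals closed under adding `a` has `a` Apéry elements. -/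
theorem count_aperyNat {T : ℕ → Prop} {a c m : ℕ} (hT : ∀ t, T t → T (t + a))
    (hc : ∀ t, c ≤ t → T t) (hm : c + a ≤ m) : Nat.count (AperyNat T a) m = a := by
  obtain ⟨k, rfl⟩ : ∃ k, m = k + a := ⟨m - a, by omega⟩
  have h := count_aperyNat_add hT k
  have h2 := Nat.count_add T k a
  have h1 : Nat.count (fun i => T (k + i)) a = a :=
    Nat.count_of_forall fun i _ => hc _ (by omega)
  omega

/-! ### Hits of a good semigroup and of its translate -/

section Semigroup

variable {S : AddSubmonoid (ℕ × ℕ)}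

theorem IsGood.mem_of_le (hS : IsGood S) {α : ℕ × ℕ} (h1 : (conductor S).1 ≤ α.1)
    (h2 : (conductor S).2 ≤ α.2) : α ∈ S := by
  have := hS.isLeast_conductor.1 (α - conductor S)
  rwa [add_tsub_cancel_of_le (show conductor S ≤ α from ⟨h1, h2⟩)] at this

theorem IsGood.isGoodSet (hS : IsGood S) : IsGoodSet (S : Set (ℕ × ℕ)) := by
  refine ⟨hS.inf_mem, fun x y hxy => ⟨?_, ?_⟩⟩
  · rintro ⟨a, ha, h⟩
    obtain ⟨δ, hδ, h1, -, h2⟩ := hS.exchange_snd _ hxy _ h rfl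
    have h3 := h2 (show x ≠ a by omega)
    simp only at h1 h3
    refine ⟨δ.2, h1, ?_⟩
    rwa [show (x, δ.2) = δ from Prod.ext (by simp only; omega) rfl]
  · rintro ⟨b, hb, h⟩
    obtain ⟨δ, hδ, h1, -, h2⟩ := hS.exchange_fst _ hxy _ h rfl
    have h3 := h2 (show y ≠ b by omega)
    simp only at h1 h3
    refine ⟨δ.1, h1, ?_⟩
    rwa [show (δ.1, y) = δ from Prod.ext rfl (by simp only; omega)]

theorem mem_shiftSet {x y : ℕ} : (x, y) ∈ shiftSet S ↔
    ∃ a b, (a, b) ∈ S ∧ a + (minElt S).1 = x ∧ b + (minElt S).2 = y := by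
  constructor
  · rintro ⟨s, hs, h⟩
    exact ⟨s.1, s.2, hs, congrArg Prod.fst h, congrArg Prod.snd h⟩
  · rintro ⟨a, b, h, rfl, rfl⟩
    exact ⟨(a, b), h, rfl⟩

theorem colHit_shiftSet {x y : ℕ} : ColHit (shiftSet S) x y ↔
    ∃ a, ColHit S a (y - (minElt S).2) ∧ a + (minElt S).1 = x := by
  constructor
  · rintro ⟨b, hb, h⟩
    obtain ⟨a, d, hd, h1, h2⟩ := mem_shiftSet.1 h
    exact ⟨a, ⟨d, by omega, hd⟩, h1⟩
  · rintro ⟨a, ⟨d, hd, h⟩, h1⟩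
    exact ⟨d + (minElt S).2, by omega, mem_shiftSet.2 ⟨a, d, h, h1, rfl⟩⟩

theorem rowHit_shiftSet {x y : ℕ} : RowHit (shiftSet S) x y ↔
    ∃ b, RowHit S (x - (minElt S).1) b ∧ b + (minElt S).2 = y := by
  constructor
  · rintro ⟨b, hb, h⟩
    obtain ⟨a, d, hd, h1, h2⟩ := mem_shiftSet.1 h
    exact ⟨d, ⟨a, by omega, hd⟩, h2⟩
  · rintro ⟨b, ⟨d, hd, h⟩, h1⟩
    exact ⟨d + (minElt S).1, by omega, mem_shiftSet.2 ⟨d, b, h, rfl, h1⟩⟩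

theorem IsGood.isGoodSet_shiftSet (hS : IsGood S) : IsGoodSet (shiftSet S) := by
  constructor
  · rintro ⟨x, y⟩ h ⟨x', y'⟩ h'
    obtain ⟨a, b, hs, rfl, rfl⟩ := mem_shiftSet.1 h
    obtain ⟨a', b', hs', rfl, rfl⟩ := mem_shiftSet.1 h'
    refine mem_shiftSet.2 ⟨min a a', min b b', hS.inf_mem _ hs _ hs', ?_, ?_⟩
    · exact (min_add_add_right _ _ _).symm
    · exact (min_add_add_right _ _ _).symm
  · intro x y h
    obtain ⟨a, b, hs, rfl, rfl⟩ := mem_shiftSet.1 h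
    have := hS.isGoodSet.row_iff_col a b hs
    rw [rowHit_shiftSet, colHit_shiftSet]
    rw [show a + (minElt S).1 + 1 - (minElt S).1 = a + 1 by omega,
      show b + (minElt S).2 + 1 - (minElt S).2 = b + 1 by omega]
    simpa using this

theorem IsGood.minElt_mem (hS : IsGood S) : minElt S ∈ S := hS.isLeast_minElt.1.1

theorem IsGood.minElt_fst_pos (hS : IsGood S) : 0 < (minElt S).1 :=
  Nat.pos_of_ne_zero fun h =>
    hS.isLeast_minElt.1.2 (hS.local_zero _ hS.minElt_mem (Or.inl h))

theorem IsGood.minElt_snd_pos (hS : IsGood S) : 0 < (minElt S).2 :=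
  Nat.pos_of_ne_zero fun h =>
    hS.isLeast_minElt.1.2 (hS.local_zero _ hS.minElt_mem (Or.inr h))

theorem IsGood.shiftSet_subset (hS : IsGood S) : shiftSet S ⊆ S := by
  rintro _ ⟨s, hs, rfl⟩
  exact S.add_mem hs hS.minElt_mem

theorem IsGood.colHit_of_le (hS : IsGood S) {x : ℕ} (y : ℕ) (h : (conductor S).1 ≤ x) :
    ColHit S x y :=
  ⟨max y (conductor S).2, le_max_left _ _, hS.mem_of_le h (le_max_right _ _)⟩

theorem IsGood.rowHit_of_le (hS : IsGood S) (x : ℕ) {y : ℕ} (h : (conductor S).2 ≤ y) :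
    RowHit S x y :=
  ⟨max x (conductor S).1, le_max_left _ _, hS.mem_of_le (le_max_right _ _) h⟩

theorem ColHit.add_minElt (hS : IsGood S) {x y : ℕ} (h : ColHit S x y) :
    ColHit S (x + (minElt S).1) y := by
  obtain ⟨b, hb, h⟩ := h
  exact ⟨b + (minElt S).2, by omega, S.add_mem h hS.minElt_mem⟩

theorem RowHit.add_minElt (hS : IsGood S) {x y : ℕ} (h : RowHit S x y) :
    RowHit S x (y + (minElt S).2) := by
  obtain ⟨b, hb, h⟩ := h
  exact ⟨b + (minElt S).1, by omega, S.add_mem h hS.minElt_mem⟩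

theorem count_col_zero_eq (k : ℕ) : Nat.count (fun i => ColGap S (shiftSet S) i 0) k =
    Nat.count (AperyNat (fun i => ColHit S i 0) (minElt S).1) k := by
  congr 1
  funext i
  simp [ColGap, AperyNat, colHit_shiftSet]

theorem count_row_zero_eq (k : ℕ) : Nat.count (fun j => RowGap S (shiftSet S) 0 j) k =
    Nat.count (AperyNat (fun j => RowHit S 0 j) (minElt S).2) k := by
  congr 1
  funext i
  simp [RowGap, AperyNat, rowHit_shiftSet]

theorem IsGood.rank_zero_fst (hS : IsGood S) {y : ℕ}
    (hy : (conductor S).2 + (minElt S).2 ≤ y) : rank S (shiftSet S) 0 y = (minElt S).2 := by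
  rw [rank, Nat.count_zero, zero_add, count_row_zero_eq]
  exact count_aperyNat (fun _ ht => ht.add_minElt hS) (fun _ ht => hS.rowHit_of_le 0 ht) hy

theorem rank_zero_snd (x : ℕ) : rank S (shiftSet S) x 0 =
    Nat.count (AperyNat (fun i => ColHit S i 0) (minElt S).1) x := by
  rw [rank, Nat.count_zero, add_zero, count_col_zero_eq]

/-! ### Symmetry and reflection of ranks -/

/-- In a symmetric good semigroup, the infinite columns are the reflections of the gaps of the
first projection. -/
theorem colHit_iff_of_symm (hsym : IsSymmetric S) {x y : ℕ}
    (hy : (conductor S).2 ≤ y) :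
    ColHit S x y ↔ ¬ ∃ p, ColHit S p 0 ∧ p + x + 1 = (conductor S).1 := by
  -- As `y ≥ c₂`, the second component of `γ - (x, y)` is negative, so `Δ^S` only asks for a point
  -- in the column `γ₁ - x`, at any height.
  constructor
  · rintro ⟨b, hb, h⟩ ⟨p, ⟨q, -, hq⟩, hp⟩
    have h1 := (hsym _).1 h
    refine Set.eq_empty_iff_forall_notMem.1 h1 (p, q) ⟨hq, Or.inl ⟨?_, ?_⟩⟩ <;>
      simp only [gam] <;> omega
  · intro hp
    refine ⟨y, le_rfl, (hsym (x, y)).2 (Set.eq_empty_iff_forall_notMem.2 ?_)⟩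
    rintro ⟨p, q⟩ ⟨hpq, ⟨h1, h2⟩ | ⟨h1, h2⟩⟩ <;> simp only [gam] at h1 h2
    · exact hp ⟨p, ⟨q, Nat.zero_le _, hpq⟩, by omega⟩
    · omega

theorem mem_of_colHit (hS : IsGood S) {x y : ℕ} (hy : (conductor S).2 ≤ y) (h : ColHit S x y) : (x, y) ∈ S :=
  hS.isGoodSet.mem_of_hits h (hS.rowHit_of_le x hy)

/-- The column gaps far up are the reflections of the Apéry elements of the first projection. -/
theorem colGap_iff_of_symm (hS : IsGood S) (hsym : IsSymmetric S) {x y : ℕ}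
    (hy : (conductor S).2 + (minElt S).2 ≤ y) :
    ColGap S (shiftSet S) x y ↔ ∃ u, AperyNat (fun i => ColHit S i 0) (minElt S).1 u ∧
      u + x + 1 = (conductor S).1 + (minElt S).1 := by
  unfold ColGap AperyNat
  rw [colHit_shiftSet, colHit_iff_of_symm hsym (by omega)]
  have h0 := hS.minElt_fst_pos
  constructor
  · rintro ⟨h1, h2⟩
    have hlt : x < (conductor S).1 + (minElt S).1 := by
      by_contra! hx
      exact h2 ⟨x - (minElt S).1, hS.colHit_of_le _ (by omega), by omega⟩
    refine ⟨(conductor S).1 + (minElt S).1 - 1 - x, ⟨?_, ?_⟩, by omega⟩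
    · rcases lt_or_ge x (minElt S).1 with hx | hx
      · exact hS.colHit_of_le _ (by omega)
      · have h3 : ¬ ColHit S (x - (minElt S).1) (y - (minElt S).2) :=
          fun hh => h2 ⟨_, hh, by omega⟩
        rw [colHit_iff_of_symm hsym (by omega), not_not] at h3
        obtain ⟨p, hp, h4⟩ := h3
        rwa [show (conductor S).1 + (minElt S).1 - 1 - x = p by omega]
    · rintro ⟨t, ht, h3⟩
      exact h1 ⟨t, ht, by omega⟩
  · rintro ⟨u, ⟨h1, h2⟩, h3⟩
    refine ⟨?_, ?_⟩
    · rintro ⟨p, hp, h4⟩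
      exact h2 ⟨p, hp, by omega⟩
    · rintro ⟨a, ha, h4⟩
      rw [colHit_iff_of_symm hsym (by omega)] at ha
      exact ha ⟨u, h1, by omega⟩

/-- The number of `i < x` satisfying the reflection of `P` in `K`. -/
theorem count_reflect {P : ℕ → Prop} {K u x : ℕ} (h : u + x = K) :
    Nat.count (fun i => ∃ v, P v ∧ v + i + 1 = K) x + Nat.count P u = Nat.count P K := by
  induction x generalizing u with
  | zero => simp [← h]
  | succ x ih =>
    rw [← ih (u := u + 1) (by omega), Nat.count_succ, Nat.count_succ]
    have : (∃ v, P v ∧ v + x + 1 = K) ↔ P u :=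
      ⟨fun ⟨v, hv, h1⟩ => by rwa [show u = v by omega], fun hu => ⟨u, hu, by omega⟩⟩
    simp only [this]
    omega

theorem IsGood.count_apery_fst (hS : IsGood S) {k : ℕ}
    (hk : (conductor S).1 + (minElt S).1 ≤ k) :
    Nat.count (AperyNat (fun i => ColHit S i 0) (minElt S).1) k = (minElt S).1 :=
  count_aperyNat (fun _ ht => ht.add_minElt hS) (fun _ ht => hS.colHit_of_le 0 ht) hk

/-- A high point has rank `e₂` plus the column gaps to its left, which reflect to the Apéry elements
of the first projection that are at least `u`; `rank` at `(u, 0)` counts those below `u`, and there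
are `e₁` in all. -/
theorem rank_reflect (hS : IsGood S) (hsym : IsSymmetric S) {u x y : ℕ}
    (hy : (conductor S).2 + (minElt S).2 ≤ y)
    (hux : u + x = (conductor S).1 + (minElt S).1) :
    rank S (shiftSet S) x y + rank S (shiftSet S) u 0 = (minElt S).1 + (minElt S).2 := by
  have h2 : (fun i => ColGap S (shiftSet S) i y) = fun i =>
      ∃ v, AperyNat (fun i => ColHit S i 0) (minElt S).1 v ∧
        v + i + 1 = (conductor S).1 + (minElt S).1 := by
    funext i
    exact propext (colGap_iff_of_symm hS hsym hy)
  have h1 := count_reflect (P := AperyNat (fun i => ColHit S i 0) (minElt S).1) hux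
  rw [hS.count_apery_fst le_rfl] at h1
  rw [rank_eq_add_count hS.shiftSet_subset hS.isGoodSet hS.isGoodSet_shiftSet,
    hS.rank_zero_fst hy, rank_zero_snd]
  simp only [h2]
  omega

theorem goodPair (hS : IsGood S) (hsym : IsSymmetric S) :
    GoodPair S (shiftSet S)
      (max ((conductor S).1 + (minElt S).1) ((conductor S).2 + (minElt S).2))
      ((minElt S).1 + (minElt S).2) := by
  have hcol : ∀ x y, (conductor S).1 + (minElt S).1 ≤ x → ColHit (shiftSet S) x y := fun x y h =>
    colHit_shiftSet.2 ⟨x - (minElt S).1, hS.colHit_of_le _ (by omega), by omega⟩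
  refine ⟨hS.shiftSet_subset, hS.isGoodSet, hS.isGoodSet_shiftSet, ?_, ?_, ?_⟩
  · exact fun x y h => hcol x y (by omega)
  · exact fun x y h =>
      rowHit_shiftSet.2 ⟨y - (minElt S).2, hS.rowHit_of_le _ (by omega), by omega⟩
  · intro x y hx hy
    obtain ⟨k, rfl⟩ : ∃ k, x = (conductor S).1 + (minElt S).1 + k :=
      Nat.exists_eq_add_of_le (by omega)
    have h1 := rank_reflect hS hsym (u := 0) (x := (conductor S).1 + (minElt S).1) (y := y)
      (by omega) (by omega)
    rw [show rank S (shiftSet S) 0 0 = 0 by simp [rank], add_zero] at h1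
    rw [← h1]
    clear hx h1
    induction k with
    | zero => rfl
    | succ k ih =>
      rw [← add_assoc, rank_succ_fst hS.shiftSet_subset hS.isGoodSet hS.isGoodSet_shiftSet, ih,
        if_neg, add_zero]
      exact fun hg => hg.2 (hcol _ y (by omega))

/-! ### Identification of the levels -/

theorem remaining_eq (hS : IsGood S) (hsym : IsSymmetric S) {k : ℕ}
    (hk : k ≤ (minElt S).1 + (minElt S).2) :
    remaining S k =
      {α ∈ apery S | rank S (shiftSet S) α.1 α.2 + k < (minElt S).1 + (minElt S).2} := by
  have hP := goodPair hS hsym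
  induction k with
  | zero =>
    ext α
    exact ⟨fun h => ⟨h, hP.rank_lt h⟩, fun h => h.1⟩
  | succ k ih =>
    have h1 : {α ∈ apery S | rank S (shiftSet S) α.1 α.2 + k < (minElt S).1 + (minElt S).2} =
        {α ∈ (S : Set (ℕ × ℕ)) \ shiftSet S |
          rank S (shiftSet S) α.1 α.2 ≤ (minElt S).1 + (minElt S).2 - (k + 1)} := by
      ext α
      exact and_congr_right fun _ => by omega
    rw [remaining, ih (by omega), h1, hP.maxSet_diff_infSet (by omega)]
    ext α
    simp only [Set.mem_sdiff, Set.mem_ofPred_eq, apery_eq, not_and]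
    constructor
    · rintro ⟨⟨h1, h2⟩, h3⟩
      have := h3 h1
      exact ⟨h1, by omega⟩
    · rintro ⟨h1, h2⟩
      exact ⟨⟨h1, by omega⟩, fun _ => by omega⟩

theorem layer_eq (hS : IsGood S) (hsym : IsSymmetric S) {k : ℕ}
    (hk : k < (minElt S).1 + (minElt S).2) :
    layer S k =
      {α ∈ apery S | rank S (shiftSet S) α.1 α.2 + k + 1 = (minElt S).1 + (minElt S).2} := by
  have h1 : remaining S k = {α ∈ (S : Set (ℕ × ℕ)) \ shiftSet S |
      rank S (shiftSet S) α.1 α.2 ≤ (minElt S).1 + (minElt S).2 - (k + 1)} := by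
    rw [remaining_eq hS hsym hk.le]
    ext α
    exact and_congr_right fun _ => by omega
  rw [layer, h1, (goodPair hS hsym).maxSet_diff_infSet (by omega)]
  ext α
  exact and_congr_right fun _ => by omega

theorem numLevels_eq (hS : IsGood S) (hsym : IsSymmetric S) :
    numLevels S = (minElt S).1 + (minElt S).2 := by
  have hP := goodPair hS hsym
  apply IsLeast.csInf_eq
  constructor
  · ext α
    simp only [Set.mem_iUnion, Finset.mem_range]
    constructor
    · intro h
      have := hP.rank_lt h
      refine ⟨(minElt S).1 + (minElt S).2 - 1 - rank S (shiftSet S) α.1 α.2, by omega, ?_⟩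
      rw [layer_eq hS hsym (by omega)]
      exact ⟨h, by omega⟩
    · rintro ⟨k, hk, h⟩
      rw [layer_eq hS hsym hk] at h
      exact h.1
  · intro m hm
    by_contra! hlt
    -- An element of rank `0` is removed only with the last layer, of index `e - 1`.
    obtain ⟨β, hβ, hr⟩ := hP.exists_rank_eq
      (m := 0) (by omega)
    have h1 : β ∈ ⋃ k ∈ Finset.range m, layer S k := by
      rw [← show apery S = ⋃ k ∈ Finset.range m, layer S k from hm]
      exact hβ
    simp only [Set.mem_iUnion, Finset.mem_range] at h1
    obtain ⟨k, hk, h⟩ := h1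
    rw [layer_eq hS hsym (by omega)] at h
    have := h.2
    omega

theorem mem_level_iff (hS : IsGood S) (hsym : IsSymmetric S) {i : ℕ} {α : ℕ × ℕ}
    (hi : i ≤ (minElt S).1 + (minElt S).2) :
    α ∈ level S i ↔ α ∈ apery S ∧ rank S (shiftSet S) α.1 α.2 + 1 = i := by
  unfold level
  rw [Set.mem_ofPred_eq, numLevels_eq hS hsym]
  constructor
  · rintro ⟨h1, k, hk, h⟩
    rw [layer_eq hS hsym (by omega)] at h
    have := h.2
    exact ⟨h.1, by omega⟩
  · rintro ⟨h1, h2⟩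
    refine ⟨by omega, (minElt S).1 + (minElt S).2 - i, by omega, ?_⟩
    rw [layer_eq hS hsym (by omega)]
    exact ⟨h1, by omega⟩

/-! ### Complementary pairs -/

/-- For every level `i ≤ e₁` there are `α` in it and an infinite column inside the complementary
level such that the abscissas add up to `c₁ + e₁ - 1`. -/
theorem exists_level_pair (hS : IsGood S) (hsym : IsSymmetric S) {i : ℕ} (h1 : 1 ≤ i)
    (hi : i ≤ (minElt S).1) :
    ∃ α ∈ level S i, ∃ x, α.1 + x + 1 = (conductor S).1 + (minElt S).1 ∧
      ∀ y, (conductor S).2 + (minElt S).2 ≤ y →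
        (x, y) ∈ level S ((minElt S).1 + (minElt S).2 + 1 - i) := by
  have hP := goodPair hS hsym
  set Q := AperyNat (fun i => ColHit S i 0) (minElt S).1 with hQ
  have hcount := hS.count_apery_fst le_rfl
  -- `u` is the `i`-th Apéry element of the first projection: one less than the first place where
  -- the count reaches `i`.
  obtain ⟨u, hu, hur⟩ : ∃ u, Q u ∧ Nat.count Q u = i - 1 := by
    have hex : ∃ k, i ≤ Nat.count Q k := ⟨_, by rw [hQ, hcount]; exact hi⟩
    have hk := Nat.find_spec hex
    have hmin := fun m => Nat.find_min (m := m) hex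
    obtain ⟨u, hu⟩ : ∃ u, Nat.find hex = u + 1 := by
      refine Nat.exists_eq_succ_of_ne_zero fun h0 => ?_
      rw [h0, Nat.count_zero] at hk
      omega
    have h2 := hmin u (by omega)
    rw [hu, Nat.count_succ] at hk
    refine ⟨u, ?_, ?_⟩
    · by_contra hn
      rw [if_neg hn] at hk
      omega
    · split_ifs at hk <;> omega
  have hr : rank S (shiftSet S) u 0 = i - 1 := by rw [rank_zero_snd, ← hQ, hur]
  have hgap : ColGap S (shiftSet S) u 0 :=
    ⟨hu.1, fun h => hu.2 (by simpa [colHit_shiftSet] using h)⟩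
  have hsucc := hP.rank_succ_fst u 0
  rw [if_pos hgap] at hsucc
  have hpos := hS.minElt_snd_pos
  obtain ⟨α, hα, ha, -, hαr⟩ := hP.exists_mem_diff (x := u) (y := 0) (by omega)
  -- The rank is already `i` at `(u + 1, 0)`, so a point of rank `i - 1` cannot lie to the right of
  -- column `u`.
  have hau : α.1 = u := by
    by_contra hne
    have := hP.rank_mono (x := u + 1) (x' := α.1) (y := 0) (y' := α.2) (by omega) (by omega)
    omega
  have hlt : u < (conductor S).1 + (minElt S).1 := by
    by_contra! hle
    exact hu.2 ⟨u - (minElt S).1, hS.colHit_of_le _ (by omega), by omega⟩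
  refine ⟨α, (mem_level_iff hS hsym (by omega)).2 ⟨hα, by omega⟩,
    (conductor S).1 + (minElt S).1 - 1 - u, by omega, fun y hy => ?_⟩
  have hg : ColGap S (shiftSet S) ((conductor S).1 + (minElt S).1 - 1 - u) y :=
    (colGap_iff_of_symm hS hsym hy).2 ⟨u, hu, by omega⟩
  have hrefl := rank_reflect hS hsym (u := u)
    (x := (conductor S).1 + (minElt S).1 - 1 - u + 1) hy (by omega)
  rw [hP.rank_succ_fst, if_pos hg] at hrefl
  refine (mem_level_iff hS hsym (by omega)).2 ⟨⟨?_, ?_⟩, by simp only; omega⟩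
  · exact mem_of_colHit hS (by omega) hg.1
  · exact fun h => hg.2 ⟨y, le_rfl, h⟩

theorem iUnion_level (hS : IsGood S) (hsym : IsSymmetric S) :
    apery S = ⋃ i ∈ Finset.Icc 1 ((minElt S).1 + (minElt S).2), level S i := by
  ext α
  simp only [Set.mem_iUnion, Finset.mem_Icc]
  constructor
  · intro h
    have := (goodPair hS hsym).rank_lt h
    exact ⟨rank S (shiftSet S) α.1 α.2 + 1, by omega,
      (mem_level_iff hS hsym (by omega)).2 ⟨h, rfl⟩⟩
  · rintro ⟨i, hi, h⟩
    exact ((mem_level_iff hS hsym hi.2).1 h).1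

/-- A common top element `ω` such that in every level `i ≤ e₁` there is an element whose
complement to `ω` lies in the complementary level; for `i = 1` it is `0`. -/
theorem exists_complements (hS : IsGood S) (hsym : IsSymmetric S) :
    ∃ (ω : ℕ × ℕ) (a b : ℕ → ℕ × ℕ), b 1 = ω ∧ ∀ i, 1 ≤ i → i ≤ (minElt S).1 →
      a i ∈ level S i ∧ b i ∈ level S ((minElt S).1 + (minElt S).2 + 1 - i) ∧
      a i + b i = ω := by
  have h0 := hS.minElt_fst_pos
  have hex : ∀ i, ∃ α : ℕ × ℕ, ∃ x : ℕ, 1 ≤ i → i ≤ (minElt S).1 →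
      α ∈ level S i ∧ α.1 + x + 1 = (conductor S).1 + (minElt S).1 ∧
      ∀ y, (conductor S).2 + (minElt S).2 ≤ y →
        (x, y) ∈ level S ((minElt S).1 + (minElt S).2 + 1 - i) := by
    intro i
    by_cases h : 1 ≤ i ∧ i ≤ (minElt S).1
    · obtain ⟨α, hα, x, h1, h2⟩ := exists_level_pair hS hsym h.1 h.2
      exact ⟨α, x, fun _ _ => ⟨hα, h1, h2⟩⟩
    · exact ⟨0, 0, fun h1 h2 => absurd ⟨h1, h2⟩ h⟩
  choose a x hax using hex
  -- By locality a nonzero element of `S` dominates `(1, 1)`, where the rank is already positive.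
  have ha1 : a 1 = 0 := by
    obtain ⟨h1, -⟩ := hax 1 le_rfl h0
    obtain ⟨hA, hr⟩ := (mem_level_iff hS hsym (by omega)).1 h1
    by_contra hne
    have hP := goodPair hS hsym
    have hz : (0 : ℕ × ℕ) ∈ (S : Set (ℕ × ℕ)) \ shiftSet S := by
      refine ⟨S.zero_mem, ?_⟩
      rintro ⟨s, -, hs⟩
      have := congrArg Prod.fst hs
      simp at this
      omega
    have hlt := hP.rank_lt_of_lt hz
    have p1 : (a 1).1 ≠ 0 := fun h => hne (hS.local_zero _ hA.1 (Or.inl h))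
    have p2 : (a 1).2 ≠ 0 := fun h => hne (hS.local_zero _ hA.1 (Or.inr h))
    have := hP.rank_mono (x := (0 : ℕ × ℕ).1 + 1) (x' := (a 1).1) (y := (0 : ℕ × ℕ).2 + 1)
      (y' := (a 1).2) (by simp; omega) (by simp; omega)
    omega
  -- The sum bounds every `(a i).2` used, so `Y - (a i).2` is an honest difference and still high
  -- enough for column `x i` to lie in its level.
  set Y := (conductor S).2 + (minElt S).2 + ∑ i ∈ Finset.range ((minElt S).1 + 1), (a i).2
    with hY
  have hle : ∀ i, i ≤ (minElt S).1 → (conductor S).2 + (minElt S).2 + (a i).2 ≤ Y := by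
    intro i hi
    have := Finset.single_le_sum (f := fun i => (a i).2) (fun _ _ => Nat.zero_le _)
      (Finset.mem_range.2 (Nat.lt_add_one_of_le hi))
    omega
  have hx1 := (hax 1 le_rfl h0).2.1
  rw [ha1] at hx1
  simp only [Prod.fst_zero, zero_add] at hx1
  refine ⟨(x 1, Y), a, fun i => (x i, Y - (a i).2), by simp [ha1], fun i h1 hi => ?_⟩
  obtain ⟨h2, h3, h4⟩ := hax i h1 hi
  have := hle i hi
  refine ⟨h2, h4 _ (by omega), Prod.ext ?_ ?_⟩
  · change (a i).1 + x i = x 1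
    omega
  · change (a i).2 + (Y - (a i).2) = Y
    omega

end Semigroup

end GoodSemi

/-! ### Assembling the two halves -/

theorem theorem5p5 (S : AddSubmonoid (ℕ × ℕ)) (hS : GoodSemi.IsGood S)
    (hsym : GoodSemi.IsSymmetric S)
    (h12 : (GoodSemi.minElt S).2 ≤ (GoodSemi.minElt S).1)
    (e : ℕ) (he : e = (GoodSemi.minElt S).1 + (GoodSemi.minElt S).2) :
    GoodSemi.apery S = (⋃ i ∈ Finset.Icc 1 e, GoodSemi.level S i) ∧
    GoodSemi.numLevels S = e ∧
    (Even e → ∃ α : ℕ → ℕ × ℕ,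
      (∀ i ∈ Finset.Icc 1 e, α i ∈ GoodSemi.level S i) ∧
      (∀ i ∈ Finset.Icc 1 e, α i + α (e - i + 1) = α e)) ∧
    (∀ d : ℕ, e + 1 = 2 * d → ∃ (α : ℕ → ℕ × ℕ) (β : ℕ × ℕ),
      (∀ i ∈ Finset.Icc 1 e, α i ∈ GoodSemi.level S i) ∧
      β ∈ GoodSemi.level S d ∧
      (∀ i ∈ Finset.Icc 1 e, i ≠ d → α i + α (e - i + 1) = α e) ∧
      α d + β = α e) := by
  obtain ⟨ω, a, b, hb1, hab⟩ := GoodSemi.exists_complements hS hsym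
  have hpos := hS.minElt_snd_pos
  rw [← he] at hab
  -- Every index `i` passed to `a` or `b` satisfies `2 * i ≤ e + 1`, hence `i ≤ e₁` because `e₂ ≤
  -- e₁`. For `e = 2d - 1` the middle index falls in the second branch, so `α d = b d` and its
  -- partner is `a d`.
  let α : ℕ → ℕ × ℕ := fun i => if 2 * i ≤ e then a i else b (e + 1 - i)
  have hlow : ∀ i, 2 * i ≤ e → α i = a i := fun i h => if_pos h
  have hhigh : ∀ i, e < 2 * i → α i = b (e + 1 - i) := fun i h => if_neg (by omega)
  have hlevel : ∀ i ∈ Finset.Icc 1 e, α i ∈ GoodSemi.level S i := by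
    intro i hi
    have hi := Finset.mem_Icc.1 hi
    rcases le_or_gt (2 * i) e with h | h
    · rw [hlow i h]
      exact (hab i hi.1 (by omega)).1
    · rw [hhigh i h]
      have := (hab (e + 1 - i) (by omega) (by omega)).2.1
      rwa [show e + 1 - (e + 1 - i) = i by omega] at this
  have htop : α e = ω := by
    rw [hhigh e (by omega), ← hb1]
    congr 1
    omega
  have hsum : ∀ i ∈ Finset.Icc 1 e, 2 * i ≠ e + 1 → α i + α (e - i + 1) = α e := by
    intro i hi hne
    have hi := Finset.mem_Icc.1 hi
    rw [htop]
    rcases le_or_gt (2 * i) e with h | h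
    · rw [hlow i h, hhigh _ (by omega), show e + 1 - (e - i + 1) = i by omega]
      exact (hab i hi.1 (by omega)).2.2
    · rw [hhigh i h, hlow _ (by omega), add_comm, show e - i + 1 = e + 1 - i by omega]
      exact (hab _ (by omega) (by omega)).2.2
  refine ⟨he ▸ GoodSemi.iUnion_level hS hsym, he ▸ GoodSemi.numLevels_eq hS hsym, ?_, ?_⟩
  · rintro ⟨k, hk⟩
    exact ⟨α, hlevel, fun i hi => hsum i hi (by omega)⟩
  · intro d hd
    have hd' := hab d (by omega) (by omega)
    refine ⟨α, a d, hlevel, hd'.1, fun i hi hne => hsum i hi (by omega), ?_⟩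
    rw [htop, hhigh d (by omega), show e + 1 - d = d by omega, add_comm]
    exact hd'.2.2
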